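/- \textbf{Theorem.} Let $K\ge 1$, let $\mathcal S\subset\mathbb R^q$ be any subset, and consider $K$-state hidden Markov models with observations in $\mathcal S$: a parameter set $(\lambda,\Gamma,F_1,\dots,F_K)$ consists of a probability vector $\lambda\in\mathbb R^K$, a $K\times K$ stochastic matrix $\Gamma=(\alpha_{j,k})$ and probability distributions $F_1,\dots,F_K$ on $\mathcal S$; under it $(X_t)_{t\ge1}$ is a time-homogeneous Markov chain on $\{1,\dots,K\}$ with initial distribution $\lambda$ (the distribution of $X_1$, not assumed stationary) and transition matrix $\Gamma$, and, given $(X_t)_{t\ge1}$, the observations $(Y_t)_{t\ge1}$ are independent with $Y_s$ having conditional distribution $F_{X_s}$. Let $(\lambda,\Gamma,F_1,\dots,F_K)$ and $(\tilde\lambda,\tilde\Gamma,\tilde F_1,\dots,\tilde F_K)$ be two such parameter sets under which the joint distributions of $(Y_1,\dots,Y_T)$ with \[ T=(2K+1)(K^2-2K+2)+1 \] are equal. Suppose that $\Gamma$ has full rank $K$ and is ergodic (irreducible and aperiodic), and that $F_1,\dots,F_K$ are pairwise distinct; nothing further is assumed about $\lambda$ or about $(\tilde\lambda,\tilde\Gamma,\tilde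 F_1,\dots,\tilde F_K)$. Then the two parameter sets coincide up to label swapping: there is a permutation $\sigma$ of $\{1,\dots,K\}$ such that $\tilde\lambda_k=\lambda_{\sigma(k)}$, $\tilde\alpha_{j,k}=\alpha_{\sigma(j),\sigma(k)}$ and $\tilde F_k=F_{\sigma(k)}$ for all $j,k\in\{1,\dots,K\}$. -/

import Mathlib

open MeasureTheory ProbabilityTheory

/-- Parameters of a `K`-state hidden Markov model with observations in the measurable space `S`:
the distribution `init` of the first latent state, the transition probability matrix `trans` of the
latent chain, and the state-dependent distributions `emission k`. -/
structure HMMParam (K : ℕ) (S : Type*) [MeasurableSpace S] where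
  /-- the initial distribution `λ` -/
  init : Fin K → ℝ
  init_mem : init ∈ stdSimplex ℝ (Fin K)
  /-- the transition probability matrix `Γ` -/
  trans : Matrix (Fin K) (Fin K) ℝ
  trans_mem : trans ∈ Matrix.rowStochastic ℝ (Fin K)
  /-- the state-dependent distributions `F_k` -/
  emission : Fin K → ProbabilityMeasure S

/-- `X` is a time-homogeneous Markov chain under `μ` with initial distribution `init` and transition
probability matrix `trans`. The index `t : ℕ` stands for time `t + 1`. -/
structure IsMarkovChain {K : ℕ} {Ω : Type*} [MeasurableSpace Ω] (μ : Measure Ω)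
    (init : Fin K → ℝ) (trans : Matrix (Fin K) (Fin K) ℝ) (X : ℕ → Ω → Fin K) : Prop where
  measurable : ∀ t, Measurable (X t)
  prob_path : ∀ (n : ℕ) (x : Fin (n + 1) → Fin K),
    μ.real {ω | ∀ i : Fin (n + 1), X i ω = x i} =
      init (x 0) * ∏ i : Fin n, trans (x i.castSucc) (x i.succ)

/-- `(X, Y)` is a hidden Markov model with parameters `θ` on the probability space `(Ω, μ)`: `X` is
a Markov chain, and given the whole latent process `X`, the observations `Y t` are independent and
`Y t` has the conditional distribution `θ.emission (X t)`. The index `t : ℕ` stands for time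
`t + 1`. -/
structure IsHMM {K : ℕ} {S : Type*} [MeasurableSpace S] {Ω : Type*} [MeasurableSpace Ω]
    (μ : Measure Ω) (θ : HMMParam K S) (X : ℕ → Ω → Fin K) (Y : ℕ → Ω → S) : Prop where
  isProbabilityMeasure : IsProbabilityMeasure μ
  chain : IsMarkovChain μ θ.init θ.trans X
  measurable_obs : ∀ t, Measurable (Y t)
  condDistrib_obs : ∀ (I : Finset ℕ) (B : ℕ → Set S), (∀ t ∈ I, MeasurableSet (B t)) →
    μ⟦⋂ t ∈ I, Y t ⁻¹' B t | MeasurableSpace.comap (fun ω t => X t ω) MeasurableSpace.pi⟧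
      =ᵐ[μ] fun ω => ∏ t ∈ I, (θ.emission (X t ω) : Measure S).real (B t)

/-- The joint distribution of the first `T` observations. -/
noncomputable def obsLaw {S : Type*} [MeasurableSpace S] {Ω : Type*} [MeasurableSpace Ω]
    (μ : Measure Ω) (Y : ℕ → Ω → S) (T : ℕ) : Measure (Fin T → S) :=
  μ.map fun ω (t : Fin T) => Y t ω

/-- Every state has period one: the greatest common divisor of its possible return times is `1`. -/
def IsAperiodicMatrix {K : ℕ} (A : Matrix (Fin K) (Fin K) ℝ) : Prop :=
  ∀ i : Fin K, ∀ d : ℕ, (∀ n : ℕ, 0 < n → 0 < (A ^ n) i i → d ∣ n) → d = 1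

/-- A finite-state transition matrix is ergodic if it is irreducible and aperiodic. -/
def IsErgodicMatrix {K : ℕ} (A : Matrix (Fin K) (Fin K) ℝ) : Prop :=
  A.IsIrreducible ∧ IsAperiodicMatrix A

/-- Two parameter sets coincide up to label swapping: a single permutation of the states carries the
initial distribution, the transition matrix and the state-dependent distributions of `θ` to those
of `θ'`. -/
def EqUpToLabelSwapping {K : ℕ} {S : Type*} [MeasurableSpace S] (θ θ' : HMMParam K S) : Prop :=
  ∃ σ : Equiv.Perm (Fin K),
    (∀ k, θ'.init k = θ.init (σ k)) ∧
    (∀ j k, θ'.trans j k = θ.trans (σ j) (σ k)) ∧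
    (∀ k, θ'.emission k = θ.emission (σ k))

/-! Letters are measurable sets, and the law of the observations gives each word `a₁ … aₙ` the
weight `v D(a₁)Γ ⋯ D(aₙ)Γ 1`, where `D(a)` is the diagonal matrix of emission probabilities. The
whole space is a letter with `D = 1`, so `Γ` itself is a letter matrix.

Forward vectors (`v` times a word matrix) and backward vectors (a word matrix times `1`) each span
`ℝ^K` at suitable lengths: if a dimension stalls, invertibility of `Γ` makes a span closed under
multiplication by all weights, and since distinct emissions separate the states,
`Submodule.eq_top_of_separating` fills the space. The forward side needs a vector without zero
entries, supplied by `v Γ^n` for `n ≥ K^2` by ergodicity.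

Choosing bases `P` of forward and `C` of backward vectors, equality of the weights of concatenated
words gives `PC = P'C'` and `P M_a C = P' M'_a C'`. Hence `Q = P⁻¹P'` intertwines the two models
letter by letter. Cancelling `Γ'` leaves `D(a)Q = Q D'(a)`, which with separation and `Q1 = 1`
forces `Q` to be a permutation matrix. -/

/-- A submodule of `ℝ^K` containing a vector without zero entries and closed under multiplication by
a point-separating family of vectors is everything. -/
theorem Submodule.eq_top_of_separating {K : ℕ} {𝒜 : Type*} (f : 𝒜 → Fin K → ℝ)
    (hsep : ∀ i j, i ≠ j → ∃ a, f a i ≠ f a j) (U : Submodule ℝ (Fin K → ℝ))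
    (hU : ∀ a, ∀ u ∈ U, f a * u ∈ U) (w : Fin K → ℝ) (hwU : w ∈ U) (hw : ∀ i, w i ≠ 0) :
    U = ⊤ := by
  have key : ∀ i, ∀ s : Finset (Fin K), i ∉ s → ∃ u ∈ U, u i ≠ 0 ∧ ∀ j ∈ s, u j = 0 := by
    intro i s
    induction s using Finset.induction_on with
    | empty => exact fun _ => ⟨w, hwU, hw i, by simp⟩
    | insert j s hj ih =>
      intro hi
      rw [Finset.mem_insert, not_or] at hi
      obtain ⟨u, huU, hui, hu⟩ := ih hi.2
      obtain ⟨a, ha⟩ := hsep i j hi.1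
      -- Multiplying by `f a - f a j` kills coordinate `j`, keeps coordinate `i` nonzero and
      -- preserves the zeros on `s`.
      refine ⟨f a * u - f a j • u, U.sub_mem (hU a u huU) (U.smul_mem _ huU), ?_, ?_⟩
      · have : (f a * u - f a j • u) i = (f a i - f a j) * u i := by
          simp [sub_mul]
        rw [this]
        exact mul_ne_zero (sub_ne_zero.2 ha) hui
      · intro k hk
        rcases Finset.mem_insert.1 hk with rfl | hk
        · simp
        · simp [hu k hk]
  rw [eq_top_iff, ← (Pi.basisFun ℝ (Fin K)).span_eq, Submodule.span_le]
  rintro _ ⟨i, rfl⟩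
  obtain ⟨u, huU, hui, hu⟩ := key i (Finset.univ.erase i) (by simp)
  have : Pi.basisFun ℝ (Fin K) i = (u i)⁻¹ • u := by
    ext j
    by_cases hj : j = i
    · subst hj; simp [hui]
    · simp [hj, hu j (by simp [hj])]
  rw [this]
  exact U.smul_mem _ huU

/-- A sequence of naturals that increases strictly from `n₀` on until it reaches `K` reaches it
after at most `K - d n₀` steps. -/
theorem Nat.le_of_lt_succ_or_le {K n₀ m : ℕ} (d : ℕ → ℕ)
    (h : ∀ n, n₀ ≤ n → d n < d (n + 1) ∨ K ≤ d (n + 1)) (hm : K ≤ d n₀ + m) : K ≤ d (n₀ + m) := by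
  have : ∀ m, min (d n₀ + m) K ≤ d (n₀ + m) := by
    intro m
    induction m with
    | zero => simp
    | succ m ih =>
      change _ ≤ d (n₀ + m + 1)
      rcases h (n₀ + m) (by omega) with h | h <;> omega
  simpa [hm] using this m

/-! ### Word matrices, their spans, and algebraic identification -/

/-- The matrix that weights the state before a transition by the likelihood of the letter `a`. -/
noncomputable def letterMatrix {K : ℕ} {𝒜 : Type*} (f : 𝒜 → Fin K → ℝ)
    (Γ : Matrix (Fin K) (Fin K) ℝ) (a : 𝒜) : Matrix (Fin K) (Fin K) ℝ :=
  Matrix.diagonal (f a) * Γ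

/-- The product of the letter matrices of a word. -/
noncomputable def wordMatrix {K : ℕ} {𝒜 : Type*} (f : 𝒜 → Fin K → ℝ)
    (Γ : Matrix (Fin K) (Fin K) ℝ) (L : List 𝒜) : Matrix (Fin K) (Fin K) ℝ :=
  (L.map (letterMatrix f Γ)).prod

section Words

open Matrix Module

variable {K : ℕ} {𝒜 : Type*} (f : 𝒜 → Fin K → ℝ) (Γ : Matrix (Fin K) (Fin K) ℝ)

@[simp]
theorem wordMatrix_nil : wordMatrix f Γ [] = 1 := rfl

@[simp]
theorem wordMatrix_cons (a : 𝒜) (L : List 𝒜) :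
    wordMatrix f Γ (a :: L) = letterMatrix f Γ a * wordMatrix f Γ L := by
  simp [wordMatrix]

@[simp]
theorem wordMatrix_append (L L' : List 𝒜) :
    wordMatrix f Γ (L ++ L') = wordMatrix f Γ L * wordMatrix f Γ L' := by
  simp [wordMatrix]

variable {f Γ}

theorem letterMatrix_of_eq_one {e : 𝒜} (he : f e = 1) : letterMatrix f Γ e = Γ := by
  simp [letterMatrix, he]

theorem wordMatrix_replicate {e : 𝒜} (he : f e = 1) (n : ℕ) :
    wordMatrix f Γ (List.replicate n e) = Γ ^ n := by
  simp [wordMatrix, letterMatrix_of_eq_one he]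

/-- The span of the backward vectors of the words of length `n`. -/
noncomputable def backwardSpan {K : ℕ} {𝒜 : Type*} (f : 𝒜 → Fin K → ℝ)
    (Γ : Matrix (Fin K) (Fin K) ℝ) (n : ℕ) : Submodule ℝ (Fin K → ℝ) :=
  Submodule.span ℝ (Set.range fun L : {L : List 𝒜 // L.length = n} => wordMatrix f Γ L *ᵥ 1)

/-- The span of the forward vectors of the words of length `n`, started at `v`. -/
noncomputable def forwardSpan {K : ℕ} {𝒜 : Type*} (f : 𝒜 → Fin K → ℝ)
    (Γ : Matrix (Fin K) (Fin K) ℝ) (v : Fin K → ℝ) (n : ℕ) : Submodule ℝ (Fin K → ℝ) :=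
  Submodule.span ℝ (Set.range fun L : {L : List 𝒜 // L.length = n} => v ᵥ* wordMatrix f Γ L)

theorem mulVec_mem_backwardSpan {n : ℕ} (a : 𝒜) {u : Fin K → ℝ} (hu : u ∈ backwardSpan f Γ n) :
    letterMatrix f Γ a *ᵥ u ∈ backwardSpan f Γ (n + 1) := by
  have : backwardSpan f Γ n ≤
      (backwardSpan f Γ (n + 1)).comap (letterMatrix f Γ a).mulVecLin := by
    refine Submodule.span_le.2 ?_
    rintro _ ⟨⟨L, hL⟩, rfl⟩
    exact Submodule.subset_span ⟨⟨a :: L, by simp [hL]⟩, by simp⟩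
  exact this hu

theorem vecMul_mem_forwardSpan {v : Fin K → ℝ} {n : ℕ} (a : 𝒜) {u : Fin K → ℝ}
    (hu : u ∈ forwardSpan f Γ v n) :
    u ᵥ* letterMatrix f Γ a ∈ forwardSpan f Γ v (n + 1) := by
  have : forwardSpan f Γ v n ≤
      (forwardSpan f Γ v (n + 1)).comap (letterMatrix f Γ a).vecMulLinear := by
    refine Submodule.span_le.2 ?_
    rintro _ ⟨⟨L, hL⟩, rfl⟩
    exact Submodule.subset_span ⟨⟨L ++ [a], by simp [hL]⟩, by simp⟩
  exact this hu

theorem one_mem_backwardSpan {e : 𝒜} (he : f e = 1) (hΓ : Γ *ᵥ 1 = 1) (n : ℕ) :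
    (1 : Fin K → ℝ) ∈ backwardSpan f Γ n := by
  induction n with
  | zero => exact Submodule.subset_span ⟨⟨[], rfl⟩, by simp⟩
  | succ n ih => simpa [letterMatrix_of_eq_one he, hΓ] using mulVec_mem_backwardSpan e ih

/-- A linear automorphism mapping one subspace into another of no larger dimension maps it onto. -/
theorem Submodule.map_eq_of_finrank_le {U W : Submodule ℝ (Fin K → ℝ)}
    (g : (Fin K → ℝ) →ₗ[ℝ] (Fin K → ℝ)) (hg : Function.Injective g) (h : U ≤ W.comap g)
    (hd : finrank ℝ W ≤ finrank ℝ U) : U.map g = W := by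
  refine Submodule.eq_of_le_of_finrank_le (Submodule.map_le_iff_le_comap.2 h) ?_
  exact hd.trans (Submodule.equivMapOfInjective g hg U).finrank_eq.le

/-- If the dimension stalls from `n` to `n + 1`, then `Γ` maps the first span onto the second, so
multiplication by `f a` keeps the second span inside itself. It also contains `1`, hence is
everything. -/
theorem backwardSpan_eq_top {e : 𝒜} (he : f e = 1) (hΓ : Γ *ᵥ 1 = 1) (hdet : IsUnit Γ)
    (hsep : ∀ i j, i ≠ j → ∃ a, f a i ≠ f a j) : backwardSpan f Γ K = ⊤ := by
  have hinj : Function.Injective Γ.mulVecLin := Matrix.mulVec_injective_of_isUnit hdet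
  have hd := Nat.le_of_lt_succ_or_le (K := K) (n₀ := 0) (m := K)
    (fun n => finrank ℝ (backwardSpan f Γ n)) (fun n _ => by
      by_contra! hcon
      have hle := hcon.1
      have hmap := Submodule.map_eq_of_finrank_le Γ.mulVecLin hinj
        (fun u hu => by
          simpa [letterMatrix_of_eq_one he] using mulVec_mem_backwardSpan e hu) hle
      have htop : backwardSpan f Γ (n + 1) = ⊤ := by
        refine Submodule.eq_top_of_separating f hsep _ (fun a u hu => ?_) 1
          (one_mem_backwardSpan he hΓ _) (by simp)
        rw [← hmap] at hu
        obtain ⟨u, hu, rfl⟩ := hu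
        have := mulVec_mem_backwardSpan a hu
        rw [letterMatrix, ← mulVec_mulVec] at this
        convert this using 1
        ext i
        simp [mulVec_diagonal]
      have := hcon.2
      rw [htop] at this
      simp at this) (Nat.le_add_left _ _)
  rw [zero_add] at hd
  exact Submodule.eq_top_of_finrank_eq (le_antisymm (Submodule.finrank_le _) (by simpa using hd))

theorem vecMul_pow_mem_forwardSpan {e : 𝒜} (he : f e = 1) (v : Fin K → ℝ) (n : ℕ) :
    v ᵥ* Γ ^ n ∈ forwardSpan f Γ v n :=
  Submodule.subset_span ⟨⟨List.replicate n e, by simp⟩, by simp [wordMatrix_replicate he]⟩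

/-- Here the weight acts before `Γ`: on a stall, cancelling `Γ` shows that the span at `n`, not `n +
1`, is closed under the weights. The vector without zeros is `v Γ^n`, so the count starts at `n₀`.
-/
theorem forwardSpan_eq_top {e : 𝒜} (he : f e = 1) (hdet : IsUnit Γ)
    (hsep : ∀ i j, i ≠ j → ∃ a, f a i ≠ f a j) {v : Fin K → ℝ} {n₀ : ℕ}
    (hv : ∀ n, n₀ ≤ n → ∀ i, (v ᵥ* Γ ^ n) i ≠ 0) : forwardSpan f Γ v (n₀ + K) = ⊤ := by
  have hinj : Function.Injective Γ.vecMulLinear := Matrix.vecMul_injective_of_isUnit hdet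
  have hd := Nat.le_of_lt_succ_or_le (K := K) (n₀ := n₀) (m := K)
    (fun n => finrank ℝ (forwardSpan f Γ v n)) (fun n hn => by
      by_contra! hcon
      have hmap := Submodule.map_eq_of_finrank_le Γ.vecMulLinear hinj
        (fun u hu => by
          simpa [letterMatrix_of_eq_one he] using vecMul_mem_forwardSpan e hu) hcon.1
      have htop : forwardSpan f Γ v n = ⊤ := by
        refine Submodule.eq_top_of_separating f hsep _ (fun a u hu => ?_) _
          (vecMul_pow_mem_forwardSpan he v n) (hv n hn)
        have := vecMul_mem_forwardSpan a hu
        rw [letterMatrix, ← vecMul_vecMul, ← hmap] at this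
        obtain ⟨u', hu', h⟩ := this
        have h : u' = _ := hinj h
        have hfu : f a * u = u' := by
          rw [h]
          ext i
          simp [vecMul_diagonal, mul_comm]
        exact hfu ▸ hu'
      have := hcon.2
      rw [← hmap, htop, ← (Submodule.equivMapOfInjective _ hinj _).finrank_eq] at this
      simp at this) (Nat.le_add_left _ _)
  exact Submodule.eq_top_of_finrank_eq (le_antisymm (Submodule.finrank_le _) (by simpa using hd))

/-- A spanning family of `ℝ^K` contains the rows of an invertible matrix. -/
theorem exists_isUnit_of_span_eq_top {ι : Type*} {v : ι → Fin K → ℝ}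
    (hv : Submodule.span ℝ (Set.range v) = ⊤) :
    ∃ g : Fin K → ι, IsUnit (Matrix.of fun i => v (g i)) := by
  obtain ⟨κ, a, -, hsp, hli⟩ := exists_linearIndependent' ℝ v
  let b := Basis.mk hli (by rw [hsp, hv])
  let σ : κ ≃ Fin K := b.indexEquiv (Pi.basisFun ℝ (Fin K))
  refine ⟨a ∘ σ.symm, ?_⟩
  rw [← Matrix.linearIndependent_rows_iff_isUnit]
  exact hli.comp _ σ.symm.injective

/-- Identification of the initial vector, the transition matrix and the letter weights from the word
weights. -/
theorem exists_perm_of_word_weights_eq {f' : 𝒜 → Fin K → ℝ} {Γ' : Matrix (Fin K) (Fin K) ℝ}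
    {v v' : Fin K → ℝ} {e : 𝒜} (he : f e = 1) (he' : f' e = 1) (hΓ : Γ *ᵥ 1 = 1)
    (hdet : IsUnit Γ) (hsep : ∀ i j, i ≠ j → ∃ a, f a i ≠ f a j) {n₀ : ℕ}
    (hv : ∀ n, n₀ ≤ n → ∀ i, (v ᵥ* Γ ^ n) i ≠ 0)
    (h : ∀ L : List 𝒜, L.length ≤ n₀ + 2 * K + 1 →
      v ⬝ᵥ (wordMatrix f Γ L *ᵥ 1) = v' ⬝ᵥ (wordMatrix f' Γ' L *ᵥ 1)) :
    ∃ σ : Equiv.Perm (Fin K), (∀ k, v' k = v (σ k)) ∧ (∀ j k, Γ' j k = Γ (σ j) (σ k)) ∧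
      ∀ a k, f' a k = f a (σ k) := by
  obtain ⟨p, hp⟩ := exists_isUnit_of_span_eq_top (forwardSpan_eq_top he hdet hsep hv)
  obtain ⟨c, hc⟩ := exists_isUnit_of_span_eq_top (backwardSpan_eq_top he hΓ hdet hsep)
  set P : Matrix (Fin K) (Fin K) ℝ := Matrix.of fun i => v ᵥ* wordMatrix f Γ (p i)
  set C : Matrix (Fin K) (Fin K) ℝ := (Matrix.of fun j => wordMatrix f Γ (c j) *ᵥ 1)ᵀ
  set P' : Matrix (Fin K) (Fin K) ℝ := Matrix.of fun i => v' ᵥ* wordMatrix f' Γ' (p i)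
  set C' : Matrix (Fin K) (Fin K) ℝ := (Matrix.of fun j => wordMatrix f' Γ' (c j) *ᵥ 1)ᵀ
  have hC : IsUnit C := (Matrix.isUnit_transpose _).2 hc
  have hPC : P * C = P' * C' := by
    ext i j
    have := h (p i ++ c j) (by simp [(p i).2, (c j).2]; omega)
    rw [wordMatrix_append, wordMatrix_append, ← mulVec_mulVec, ← mulVec_mulVec, dotProduct_mulVec,
      dotProduct_mulVec v'] at this
    exact this
  have hPMC : ∀ a, P * (letterMatrix f Γ a * C) = P' * (letterMatrix f' Γ' a * C') := by
    intro a
    ext i j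
    have := h (p i ++ a :: c j) (by simp [(p i).2, (c j).2]; omega)
    simp only [wordMatrix_append, wordMatrix_cons, ← mulVec_mulVec] at this
    rw [dotProduct_mulVec, dotProduct_mulVec v'] at this
    exact this
  have hvC : v ᵥ* C = v' ᵥ* C' := by
    ext j
    exact h (c j) (by simp [(c j).2]; omega)
  have hP1 : P *ᵥ 1 = P' *ᵥ 1 := by
    ext i
    have := h (p i) (by simp [(p i).2]; omega)
    rwa [dotProduct_mulVec, dotProduct_mulVec v'] at this
  have hu : IsUnit (P' * C') := hPC ▸ hp.mul hC
  rw [Matrix.isUnit_iff_isUnit_det, det_mul, IsUnit.mul_iff, ← Matrix.isUnit_iff_isUnit_det,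
    ← Matrix.isUnit_iff_isUnit_det] at hu
  obtain ⟨hp', hcc'⟩ := hu
  obtain ⟨R, hR⟩ := hp.exists_left_inv
  set Q := R * P' with hQ
  have hPQ : P * Q = P' := by
    rw [hQ, ← mul_assoc, mul_eq_one_comm.1 hR, one_mul]
  have hQu : IsUnit Q := by
    rw [hQ]
    exact (IsUnit.of_mul_eq_one _ hR).mul hp'
  have hCQ : C = Q * C' := hp.mul_left_cancel (by rw [hPC, ← mul_assoc, hPQ])
  have hMQ : ∀ a, letterMatrix f Γ a * Q = Q * letterMatrix f' Γ' a := by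
    intro a
    refine hcc'.mul_right_cancel (hp.mul_left_cancel ?_)
    rw [mul_assoc _ Q, ← hCQ, hPMC, mul_assoc, ← mul_assoc P, hPQ]
  have hΓQ : Γ * Q = Q * Γ' := by
    simpa [letterMatrix_of_eq_one he, letterMatrix_of_eq_one he'] using hMQ e
  -- Invertibility of the second transition matrix is a consequence of the intertwining.
  have hΓ' : IsUnit Γ' := by
    have : IsUnit (Q * Γ') := hΓQ ▸ hdet.mul hQu
    rw [Matrix.isUnit_iff_isUnit_det, det_mul, IsUnit.mul_iff, ← Matrix.isUnit_iff_isUnit_det,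
      ← Matrix.isUnit_iff_isUnit_det] at this
    exact this.2
  have hDQ : ∀ a, diagonal (f a) * Q = Q * diagonal (f' a) := by
    intro a
    refine hΓ'.mul_right_cancel ?_
    rw [mul_assoc, ← hΓQ, ← mul_assoc, mul_assoc Q]
    exact hMQ a
  have hentry : ∀ a i j, Q i j ≠ 0 → f a i = f' a j := by
    intro a i j hij
    have := congrFun (congrFun (hDQ a) i) j
    rw [diagonal_mul, mul_diagonal, mul_comm] at this
    exact mul_left_cancel₀ hij this
  have hQ1 : Q *ᵥ 1 = 1 := by
    rw [hQ, ← mulVec_mulVec, ← hP1, mulVec_mulVec, hR, one_mulVec]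
  have hvQ : v ᵥ* Q = v' := by
    refine Matrix.vecMul_injective_of_isUnit hcc' ?_
    change (v ᵥ* Q) ᵥ* C' = v' ᵥ* C'
    rw [vecMul_vecMul, ← hCQ, hvC]
  have hdetQ : Q.det ≠ 0 := ((Matrix.isUnit_iff_isUnit_det _).1 hQu).ne_zero
  -- A nonzero term of the Leibniz expansion provides the permutation.
  rw [det_apply] at hdetQ
  obtain ⟨σ, -, hσ⟩ := Finset.exists_ne_zero_of_sum_ne_zero hdetQ
  have hσ : ∀ j, Q (σ j) j ≠ 0 := by
    intro j hj
    have : ∏ i, Q (σ i) i = 0 := Finset.prod_eq_zero (Finset.mem_univ j) hj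
    exact hσ (by simp [this])
  have hff : ∀ a k, f' a k = f a (σ k) := fun a k => (hentry a _ _ (hσ k)).symm
  have hQ0 : ∀ i j, i ≠ σ j → Q i j = 0 := by
    intro i j hij
    by_contra hne
    obtain ⟨a, ha⟩ := hsep i (σ j) hij
    exact ha (by rw [hentry a _ _ hne, hff])
  have hQσ : ∀ j, Q (σ j) j = 1 := by
    intro j
    have := congrFun hQ1 (σ j)
    simp only [mulVec, dotProduct_one, Pi.one_apply] at this
    rwa [Finset.sum_eq_single j (fun k _ hk => hQ0 _ _ fun h => hk (σ.injective h).symm)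
      (by simp)] at this
  have hmul : ∀ (w : Fin K → ℝ) j, (w ᵥ* Q) j = w (σ j) := by
    intro w j
    simp only [vecMul, dotProduct]
    rw [Finset.sum_eq_single (σ j) (fun k _ hk => by rw [hQ0 _ _ hk, mul_zero]) (by simp),
      hQσ, mul_one]
  refine ⟨σ, fun k => by rw [← hvQ, hmul], fun j k => ?_, hff⟩
  have h1 := congrFun (congrFun hΓQ (σ j)) k
  rw [mul_apply_eq_vecMul, hmul, mul_apply,
    Finset.sum_eq_single j (fun i _ hi => by rw [hQ0 _ _ fun h => hi (σ.injective h).symm, zero_mul])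
      (by simp), hQσ, one_mul] at h1
  exact h1.symm

end Words

/-! ### Positivity of powers of an ergodic matrix -/

section Positivity

open Matrix

variable {K : ℕ} {A : Matrix (Fin K) (Fin K) ℝ}

theorem Matrix.pow_add_apply_pos_iff (hA : ∀ i j, 0 ≤ A i j) (m n : ℕ) (i j : Fin K) :
    0 < (A ^ (m + n)) i j ↔ ∃ k, 0 < (A ^ m) i k ∧ 0 < (A ^ n) k j := by
  have h0 := Matrix.pow_apply_nonneg hA
  rw [pow_add, mul_apply]
  constructor
  · intro h
    obtain ⟨k, -, hk⟩ := Finset.exists_ne_zero_of_sum_ne_zero h.ne'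
    exact ⟨k, (h0 m i k).lt_of_ne' (left_ne_zero_of_mul hk),
      (h0 n k j).lt_of_ne' (right_ne_zero_of_mul hk)⟩
  · rintro ⟨k, h1, h2⟩
    exact Finset.sum_pos' (fun l _ => mul_nonneg (h0 m i l) (h0 n l j))
      ⟨k, Finset.mem_univ k, mul_pos h1 h2⟩

/-- In an irreducible chain with `K` states every state is reached from every state within `K`
steps. -/
theorem Matrix.IsIrreducible.exists_pow_pos_le (h : A.IsIrreducible) (i j : Fin K) :
    ∃ l, 0 < l ∧ l ≤ K ∧ 0 < (A ^ l) i j := by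
  classical
  have hA := h.nonneg
  have hpow := (isIrreducible_iff_exists_pow_pos hA).1 h
  let U : ℕ → Finset (Fin K) := fun n => {j | ∃ l, 0 < l ∧ l ≤ n ∧ 0 < (A ^ l) i j}
  have hU : ∀ n j, j ∈ U n ↔ ∃ l, 0 < l ∧ l ≤ n ∧ 0 < (A ^ l) i j := fun n j => by simp [U]
  have hmono : ∀ n, U n ⊆ U (n + 1) := fun n j hj => by
    obtain ⟨l, h0, hl, hlp⟩ := (hU n j).1 hj
    exact (hU _ _).2 ⟨l, h0, by omega, hlp⟩
  have hd := Nat.le_of_lt_succ_or_le (K := K) (n₀ := 0) (m := K) (fun n => (U n).card)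
    (fun n _ => by
      by_contra! hcon
      have heq := Finset.eq_of_subset_of_card_le (hmono n) hcon.1
      -- A stalled reachable set is closed under one more step, so it already contains everything
      -- reachable.
      have hall : ∀ k j, 0 < (A ^ (k + 1)) i j → j ∈ U n := by
        intro k
        induction k with
        | zero => exact fun j hj => heq ▸ (hU _ _).2 ⟨1, by omega, by omega, hj⟩
        | succ k ih =>
          intro j hj
          obtain ⟨m, hm, hmj⟩ := (pow_add_apply_pos_iff hA (k + 1) 1 i j).1 hj
          obtain ⟨l, h0, hl, hlp⟩ := (hU n m).1 (ih m hm)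
          rw [heq]
          exact (hU _ _).2 ⟨l + 1, by omega, by omega,
            (pow_add_apply_pos_iff hA l 1 i j).2 ⟨m, hlp, hmj⟩⟩
      have huniv : U n = Finset.univ := by
        refine Finset.eq_univ_of_forall fun j => ?_
        obtain ⟨k, hk, hkj⟩ := hpow i j
        exact hall (k - 1) j (by rwa [Nat.sub_add_cancel hk])
      have := hcon.2
      rw [← heq, huniv] at this
      simp at this) (Nat.le_add_left _ _)
  rw [zero_add] at hd
  have huniv : U K = Finset.univ := by
    rw [← Finset.card_eq_iff_eq_univ]
    exact le_antisymm (Finset.card_le_univ _) (by simpa using hd)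
  exact (hU K j).1 (huniv ▸ Finset.mem_univ j)

/-- The return probabilities to a state of period one are eventually positive. -/
theorem IsAperiodicMatrix.exists_forall_pow_pos (hA : ∀ i j, 0 ≤ A i j) (h : IsAperiodicMatrix A)
    (c : Fin K) : ∃ N, ∀ n, N ≤ n → 0 < (A ^ n) c c := by
  let s : AddSubmonoid ℕ :=
    { carrier := {n | 0 < (A ^ n) c c}
      zero_mem' := by simp
      add_mem' := fun {m n} hm hn => (pow_add_apply_pos_iff hA m n c c).2 ⟨c, hm, hn⟩ }
  have hs : Nat.setGcd s = 1 := h c _ fun n _ hn => Nat.setGcd_dvd_of_mem hn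
  obtain ⟨N, hN⟩ := Nat.exists_mem_closure_of_ge (s : Set ℕ)
  refine ⟨N, fun n hn => ?_⟩
  have := hN n hn (by rw [hs]; exact one_dvd n)
  rwa [AddSubmonoid.closure_eq] at this

/-- If the state `c` returns to itself with positive probability after `g` steps, then all states of
an ergodic chain are reached from `c` at time `g * (K - 1)`. -/
theorem IsErgodicMatrix.pow_mul_pos (h : IsErgodicMatrix A) {g : ℕ} (hg : 0 < g) (c : Fin K)
    (hc : 0 < (A ^ g) c c) (j : Fin K) : 0 < (A ^ (g * (K - 1))) c j := by
  classical
  have hA := h.1.nonneg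
  have hpow := (isIrreducible_iff_exists_pow_pos hA).1 h.1
  let U : ℕ → Finset (Fin K) := fun n => {j | 0 < (A ^ (g * n)) c j}
  have hU : ∀ n j, j ∈ U n ↔ 0 < (A ^ (g * n)) c j := fun n j => by simp [U]
  have hmono : ∀ n, U n ⊆ U (n + 1) := fun n j hj => by
    rw [hU, mul_add, mul_one, add_comm, pow_add_apply_pos_iff hA]
    exact ⟨c, hc, (hU n j).1 hj⟩
  obtain ⟨N, hN⟩ := h.2.exists_forall_pow_pos hA c
  have hc0 : ∀ n, c ∈ U n := by
    intro n
    induction n with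
    | zero => simp [hU]
    | succ n ih => exact hmono n ih
  have hd := Nat.le_of_lt_succ_or_le (K := K) (n₀ := 0) (m := K - 1) (fun n => (U n).card)
    (fun n _ => by
      by_contra! hcon
      have heq := Finset.eq_of_subset_of_card_le (hmono n) hcon.1
      have hall : ∀ m, U m ⊆ U n := by
        intro m
        induction m with
        | zero =>
          intro j hj
          have : j = c := by
            by_contra hne
            simp [hU, one_apply_ne' hne] at hj
          exact this ▸ hc0 n
        | succ m ih =>
          intro j hj
          rw [hU, mul_add, mul_one, pow_add_apply_pos_iff hA] at hj
          obtain ⟨k, hk, hkj⟩ := hj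
          rw [heq, hU, mul_add, mul_one, pow_add_apply_pos_iff hA]
          exact ⟨k, (hU n k).1 (ih ((hU m k).2 hk)), hkj⟩
      -- Aperiodicity enters here: spend the surplus time, at least `N`, on a return to `c`, then
      -- take `l` steps to `j`.
      have huniv : U n = Finset.univ := by
        refine Finset.eq_univ_of_forall fun j => ?_
        obtain ⟨l, -, hl⟩ := hpow c j
        refine hall (N + l) ((hU _ _).2 ?_)
        have hle : N + l ≤ g * (N + l) := Nat.le_mul_of_pos_left _ hg
        have hsplit : g * (N + l) = (g * (N + l) - l) + l := by omega
        rw [hsplit, pow_add_apply_pos_iff hA]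
        exact ⟨c, hN _ (by omega), hl⟩
      have := hcon.2
      rw [← heq, huniv] at this
      -- The count starts at one, since `c ∈ U 0`; hence `K - 1` rounds suffice.
      simp at this) (by
        have := Finset.card_pos.2 ⟨c, hc0 0⟩
        omega)
  rw [zero_add] at hd
  have huniv : U (K - 1) = Finset.univ := by
    rw [← Finset.card_eq_iff_eq_univ]
    exact le_antisymm (Finset.card_le_univ _) (by simpa using hd)
  exact (hU _ j).1 (huniv ▸ Finset.mem_univ j)

/-- The powers of an ergodic `K × K` matrix are entrywise positive from the exponent `K ^ 2` on. -/
theorem IsErgodicMatrix.pow_pos (h : IsErgodicMatrix A) {n : ℕ} (hn : K ^ 2 ≤ n) (i j : Fin K) :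
    0 < (A ^ n) i j := by
  have hA := h.1.nonneg
  obtain ⟨l, hl0, hlK, hl⟩ := h.1.exists_pow_pos_le i i
  have hle : l * (K - 1) + l ≤ K ^ 2 := by
    have hK : 0 < K := i.pos
    obtain ⟨k, rfl⟩ : ∃ k, K = k + 1 := ⟨K - 1, by omega⟩
    rw [Nat.add_sub_cancel]
    nlinarith
  -- Once a row of a power is positive it stays so, because every state has a predecessor.
  have hpos : ∀ m j, 0 < (A ^ (l * (K - 1) + m)) i j := by
    intro m
    induction m with
    | zero => exact h.pow_mul_pos hl0 i hl
    | succ m ih =>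
      intro j
      obtain ⟨k, hk0, -, hk⟩ := h.1.exists_pow_pos_le j j
      obtain ⟨k, rfl⟩ : ∃ k', k = k' + 1 := ⟨k - 1, by omega⟩
      obtain ⟨p, -, hp⟩ := (pow_add_apply_pos_iff hA k 1 j j).1 hk
      rw [← add_assoc, pow_add_apply_pos_iff hA]
      exact ⟨p, ih p, hp⟩
  obtain ⟨m, rfl⟩ : ∃ m, n = l * (K - 1) + m := ⟨n - l * (K - 1), by omega⟩
  exact hpos m j

theorem IsErgodicMatrix.vecMul_pow_pos (h : IsErgodicMatrix A) {v : Fin K → ℝ}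
    (hv : v ∈ stdSimplex ℝ (Fin K)) {n : ℕ} (hn : K ^ 2 ≤ n) (j : Fin K) :
    0 < (v ᵥ* A ^ n) j := by
  have hne : ∑ i, v i ≠ 0 := by rw [hv.2]; exact one_ne_zero
  obtain ⟨i, -, hi⟩ := Finset.exists_ne_zero_of_sum_ne_zero hne
  exact Finset.sum_pos' (fun k _ => mul_nonneg (hv.1 k) (h.pow_pos hn k j).le)
    ⟨i, Finset.mem_univ i, mul_pos ((hv.1 i).lt_of_ne' hi) (h.pow_pos hn i j)⟩

end Positivity

/-! ### From observation laws to word weights -/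

section PathSum

open Matrix

/-- The word weights are sums over paths of the chain. -/
theorem sum_path_eq_wordMatrix {K : ℕ} {𝒜 : Type*} (f : 𝒜 → Fin K → ℝ)
    (Γ : Matrix (Fin K) (Fin K) ℝ) (n : ℕ) (v : Fin K → ℝ) (b : Fin (n + 1) → 𝒜)
    (hΓ : Γ *ᵥ 1 = 1) :
    ∑ x : Fin (n + 1) → Fin K, v (x 0) * (∏ i : Fin n, Γ (x i.castSucc) (x i.succ)) *
        ∏ i, f (b i) (x i) =
      v ⬝ᵥ (wordMatrix f Γ (List.ofFn b) *ᵥ 1) := by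
  induction n generalizing v with
  | zero =>
    rw [← (Equiv.funUnique (Fin 1) (Fin K)).symm.sum_comp]
    simp [letterMatrix, dotProduct, ← mulVec_mulVec, hΓ, mulVec_diagonal]
  | succ n ih =>
    -- The first letter is absorbed into the initial vector.
    have := ih (v ᵥ* letterMatrix f Γ (b 0)) (fun i => b i.succ)
    rw [List.ofFn_succ, wordMatrix_cons, ← mulVec_mulVec, dotProduct_mulVec, ← this,
      ← (Fin.consEquiv fun _ => Fin K).sum_comp, Fintype.sum_prod_type_right]
    refine Finset.sum_congr rfl fun y _ => ?_
    simp only [vecMul, dotProduct, letterMatrix, diagonal_mul, Finset.sum_mul]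
    refine Finset.sum_congr rfl fun k _ => ?_
    simp only [Fin.consEquiv_apply, Fin.cons_zero, Fin.prod_univ_succ (n := n + 1), Fin.cons_succ,
      Fin.prod_univ_succ (n := n), Fin.castSucc_zero, ← Fin.succ_castSucc]
    ring

end PathSum

/-- The emission probabilities of the measurable sets. -/
noncomputable def HMMParam.weight {K : ℕ} {S : Type*} [MeasurableSpace S] (θ : HMMParam K S)
    (a : {A : Set S // MeasurableSet A}) (k : Fin K) : ℝ :=
  (θ.emission k : Measure S).real a

theorem ProbabilityMeasure.ext_of_real {S : Type*} [MeasurableSpace S] {ν ν' : ProbabilityMeasure S}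
    (h : ∀ A, MeasurableSet A → (ν : Measure S).real A = (ν' : Measure S).real A) : ν = ν' := by
  refine Subtype.ext (Measure.ext fun A hA => ?_)
  exact (measureReal_eq_measureReal_iff (μ := (ν : Measure S)) (ν := (ν' : Measure S))
    (measure_ne_top _ _) (measure_ne_top _ _)).1 (h A hA)

section HMM

open Matrix

variable {K : ℕ} {S : Type*} [MeasurableSpace S] {Ω : Type*} [MeasurableSpace Ω]
  {μ : Measure Ω} {θ : HMMParam K S} {X : ℕ → Ω → Fin K} {Y : ℕ → Ω → S}

/-- Conditioning on the latent chain turns the probability into the mean of a product of emission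
probabilities, a finite sum over paths. -/
theorem IsHMM.measureReal_iInter (h : IsHMM μ θ X Y) (n : ℕ) (B : ℕ → Set S)
    (hB : ∀ t, MeasurableSet (B t)) :
    μ.real (⋂ t ∈ Finset.range (n + 1), Y t ⁻¹' B t) =
      θ.init ⬝ᵥ (wordMatrix θ.weight θ.trans
        (List.ofFn fun i : Fin (n + 1) => (⟨B i, hB i⟩ : {A : Set S // MeasurableSet A})) *ᵥ 1) := by
  have := h.isProbabilityMeasure
  have hX := h.chain.measurable
  have hmeas : MeasurableSet (⋂ t ∈ Finset.range (n + 1), Y t ⁻¹' B t) :=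
    Finset.measurableSet_biInter _ fun t _ => h.measurable_obs t (hB t)
  have hle : MeasurableSpace.comap (fun ω t => X t ω) MeasurableSpace.pi ≤ ‹MeasurableSpace Ω› :=
    (measurable_pi_lambda _ hX).comap_le
  let Z : Ω → Fin (n + 1) → Fin K := fun ω i => X i ω
  have hZ : Measurable Z := measurable_pi_lambda _ fun i => hX i
  let g : (Fin (n + 1) → Fin K) → ℝ := fun x =>
    ∏ i : Fin (n + 1), θ.weight ⟨B i, hB i⟩ (x i)
  calc μ.real (⋂ t ∈ Finset.range (n + 1), Y t ⁻¹' B t)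
      = ∫ ω, (⋂ t ∈ Finset.range (n + 1), Y t ⁻¹' B t).indicator (fun _ => (1 : ℝ)) ω ∂μ := by
        rw [integral_indicator_const _ hmeas]; simp
    _ = ∫ ω, (μ⟦⋂ t ∈ Finset.range (n + 1), Y t ⁻¹' B t |
          MeasurableSpace.comap (fun ω t => X t ω) MeasurableSpace.pi⟧) ω ∂μ :=
        (integral_condExp hle).symm
    _ = ∫ ω, g (Z ω) ∂μ := by
        refine integral_congr_ae ((h.condDistrib_obs _ B fun t _ => hB t).trans (.of_forall ?_))
        intro ω
        exact Finset.prod_range fun t => (θ.emission (X t ω) : Measure S).real (B t)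
    _ = ∫ x, g x ∂(μ.map Z) :=
        (integral_map hZ.aemeasurable (measurable_of_finite g).aestronglyMeasurable).symm
    _ = ∑ x, (μ.map Z).real {x} * g x := by
        have := Measure.isProbabilityMeasure_map (μ := μ) hZ.aemeasurable
        rw [integral_fintype (Integrable.of_finite)]
        rfl
    _ = _ := by
        rw [← sum_path_eq_wordMatrix _ _ _ _ _ (one_vecMul_of_mem_rowStochastic θ.trans_mem)]
        refine Finset.sum_congr rfl fun x _ => ?_
        rw [← h.chain.prob_path n x, map_measureReal_apply hZ (measurableSet_singleton x)]
        congr 2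
        ext ω
        simp [Z, funext_iff]

theorem IsHMM.obsLaw_real_pi (h : IsHMM μ θ X Y) (n : ℕ) (B : ℕ → Set S)
    (hB : ∀ t, MeasurableSet (B t)) :
    (obsLaw μ Y (n + 1)).real (Set.univ.pi fun i : Fin (n + 1) => B i) =
      θ.init ⬝ᵥ (wordMatrix θ.weight θ.trans
        (List.ofFn fun i : Fin (n + 1) => (⟨B i, hB i⟩ : {A : Set S // MeasurableSet A})) *ᵥ 1) := by
  rw [← h.measureReal_iInter n B hB, obsLaw, map_measureReal_apply
    (measurable_pi_lambda (fun ω (t : Fin (n + 1)) => Y t ω) fun i => h.measurable_obs _)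
    (MeasurableSet.univ_pi fun i => hB i)]
  congr 1
  ext ω
  simp [Fin.forall_iff]

variable {Ω' : Type*} [MeasurableSpace Ω'] {μ' : Measure Ω'} {θ' : HMMParam K S}
  {X' : ℕ → Ω' → Fin K} {Y' : ℕ → Ω' → S}

theorem HMMParam.weight_univ (θ : HMMParam K S) :
    θ.weight ⟨Set.univ, MeasurableSet.univ⟩ = 1 := by
  ext k
  simp [HMMParam.weight]

theorem wordMatrix_append_replicate_mulVec_one {𝒜 : Type*} {f : 𝒜 → Fin K → ℝ}
    {Γ : Matrix (Fin K) (Fin K) ℝ} {e : 𝒜} (he : f e = 1) (hΓ : Γ *ᵥ 1 = 1) (L : List 𝒜) (r : ℕ) :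
    wordMatrix f Γ (L ++ List.replicate r e) *ᵥ 1 = wordMatrix f Γ L *ᵥ 1 := by
  have : Γ ^ r *ᵥ 1 = 1 := by
    induction r with
    | zero => simp
    | succ r ih => rw [pow_succ, ← mulVec_mulVec, hΓ, ih]
  rw [wordMatrix_append, wordMatrix_replicate he, ← mulVec_mulVec, this]

/-- Two hidden Markov models whose first `n + 1` observations have the same law give the same weight
to all words of length at most `n + 1`. -/
theorem IsHMM.word_weight_eq (h : IsHMM μ θ X Y) (h' : IsHMM μ' θ' X' Y') {n : ℕ}
    (hlaw : obsLaw μ Y (n + 1) = obsLaw μ' Y' (n + 1)) (L : List {A : Set S // MeasurableSet A})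
    (hL : L.length ≤ n + 1) :
    θ.init ⬝ᵥ (wordMatrix θ.weight θ.trans L *ᵥ 1) =
      θ'.init ⬝ᵥ (wordMatrix θ'.weight θ'.trans L *ᵥ 1) := by
  rw [← wordMatrix_append_replicate_mulVec_one θ.weight_univ
      (one_vecMul_of_mem_rowStochastic θ.trans_mem) L (n + 1 - L.length),
    ← wordMatrix_append_replicate_mulVec_one θ'.weight_univ
      (one_vecMul_of_mem_rowStochastic θ'.trans_mem) L (n + 1 - L.length)]
  -- Padding with the whole space brings every word to length `n + 1` without changing its weight.
  set L' := L ++ List.replicate (n + 1 - L.length) (⟨Set.univ, MeasurableSet.univ⟩ :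
    {A : Set S // MeasurableSet A})
  have hL' : L'.length = n + 1 := by simp [L']; omega
  let B : ℕ → {A : Set S // MeasurableSet A} := fun t => L'.getD t ⟨Set.univ, MeasurableSet.univ⟩
  have hB : (List.ofFn fun i : Fin (n + 1) => (⟨B i, (B i).2⟩ : {A : Set S // MeasurableSet A})) =
      L' := by
    refine List.ext_getElem (by simp [hL']) fun i h1 h2 => ?_
    rw [List.getElem_ofFn]
    exact List.getD_eq_getElem _ _ h2
  have e1 := h.obsLaw_real_pi n (fun t => B t) fun t => (B t).2
  have e2 := h'.obsLaw_real_pi n (fun t => B t) fun t => (B t).2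
  rw [hB] at e1 e2
  rw [← e1, ← e2, hlaw]

end HMM

theorem mainTheorem3 (q : ℕ) (S : Set (EuclideanSpace ℝ (Fin q))) (K : ℕ)
    (θ θ' : HMMParam K S)
    (h_rank : θ.trans.rank = K)
    (h_ergodic : IsErgodicMatrix θ.trans)
    (h_distinct : Function.Injective θ.emission)
    {Ω Ω' : Type*} [MeasurableSpace Ω] [MeasurableSpace Ω']
    (μ : Measure Ω) (μ' : Measure Ω')
    (X : ℕ → Ω → Fin K) (Y : ℕ → Ω → S) (X' : ℕ → Ω' → Fin K) (Y' : ℕ → Ω' → S)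
    (hXY : IsHMM μ θ X Y) (hXY' : IsHMM μ' θ' X' Y')
    -- `K ^ 2 + 2 - 2 * K` is never truncated, since `2 * K ≤ K ^ 2 + 2`
    (h_law : obsLaw μ Y ((2 * K + 1) * (K ^ 2 + 2 - 2 * K) + 1) =
      obsLaw μ' Y' ((2 * K + 1) * (K ^ 2 + 2 - 2 * K) + 1)) :
    EqUpToLabelSwapping θ θ' := by
  have hunit : IsUnit θ.trans := by
    rw [← Matrix.linearIndependent_rows_iff_isUnit, linearIndependent_iff_card_eq_finrank_span,
      Fintype.card_fin]
    exact h_rank.symm.trans (Matrix.rank_eq_finrank_span_row _)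
  have hsep : ∀ i j, i ≠ j → ∃ a, θ.weight a i ≠ θ.weight a j := by
    intro i j hij
    by_contra! hcon
    exact hij (h_distinct (ProbabilityMeasure.ext_of_real fun A hA => hcon ⟨A, hA⟩))
  -- The longest word needed is forward (`K ^ 2 + K`), one letter, backward (`K`). The bound is an
  -- equality at `K = 1`.
  have hlen : K ^ 2 + 2 * K + 1 ≤ (2 * K + 1) * (K ^ 2 + 2 - 2 * K) + 1 := by
    have hK : K ≠ 0 := by
      rintro rfl
      simpa using θ.init_mem.2
    obtain ⟨k, rfl⟩ := Nat.exists_eq_succ_of_ne_zero hK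
    have : (k.succ) ^ 2 + 2 - 2 * k.succ = k ^ 2 + 1 := by
      have : k.succ ^ 2 + 2 = k ^ 2 + 1 + 2 * k.succ := by simp only [Nat.succ_eq_add_one]; ring
      omega
    rw [this, Nat.succ_eq_add_one]
    rcases k with _ | k
    · norm_num
    · nlinarith [sq_nonneg k]
  obtain ⟨σ, h1, h2, h3⟩ := exists_perm_of_word_weights_eq θ.weight_univ θ'.weight_univ
    (Matrix.one_vecMul_of_mem_rowStochastic θ.trans_mem) hunit hsep
    (fun n hn i => (h_ergodic.vecMul_pow_pos θ.init_mem hn i).ne')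
    (fun L hL => hXY.word_weight_eq hXY' h_law L (hL.trans hlen))
  exact ⟨σ, h1, h2, fun k => ProbabilityMeasure.ext_of_real fun A hA => h3 ⟨A, hA⟩ k⟩
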